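/- Let FO$^2$ be the set of first-order formulas with equality, over relational signatures (no function or constant symbols; relation symbols of arbitrary finite arity), that use only two distinct variables, free or bound. Structures have non-empty domains. For tuples $\mathbf a=(a_1,\dots,a_n)$ in $\mathfrak A$ and $\mathbf b=(b_1,\dots,b_n)$ in $\mathfrak B$, and a signature $\tau$, we say that $\mathbf a\mapsto\mathbf b$ is a partial $\tau$-isomorphism if $a_i\mapsto b_i$ is an isomorphism from the $\tau$-reduct of $\mathfrak A$ restricted to $\{a_1,\dots,a_n\}$ onto the $\tau$-reduct of $\mathfrak B$ restricted to $\{b_1,\dots,b_n\}$. An FO$^2(\tau)$-bisimulation between $\mathfrak A$ and $\mathfrak B$ is a relation $S\subseteq \mathrm{dom}(\mathfrak A)\times\mathrm{dom}(\mathfrak B)$ such that every element of $\mathrm{dom}(\mathfrak A)$ and every element of $\mathrm{dom}(\mathfrak B)$ occurs in some pair of $S$, and for every $(a,b)\in S$: (i) for every $a'\in\mathrm{dom}(\mathfrak A)$ there is $b'$ with $(a',b')\in S$ such that $(a,a')\mapsto(b,b')$ is a partial $\tau$-isomorphism; (ii) for every $b'\in\mathrm{dom}(\mathfrak B)$ there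 is $a'$ with $(a',b')\in S$ such that $(a,a')\mapsto(b,b')$ is a partial $\tau$-isomorphism. For $n\le 2$ write $\mathfrak A,\mathbf a\sim_{\mathrm{FO}^2,\tau}\mathfrak B,\mathbf b$ if $\mathbf a\mapsto\mathbf b$ is a partial $\tau$-isomorphism and there is an FO$^2(\tau)$-bisimulation $S$ between $\mathfrak A$ and $\mathfrak B$ with $(a_i,b_i)\in S$ for all $i$. Let $|\chi|$ denote the number of symbol occurrences in the formula $\chi$ (brackets and commas not counted). Then there is an absolute constant $C$ such that the following holds for every relational signature $\tau$ and all FO$^2$-formulas $\varphi(\mathbf x_0),\psi(\mathbf x_0)$, where $\mathbf x_0$ is a tuple of at most two distinct variables containing all free variables of $\varphi$ and $\psi$. If $\varphi(\mathbf x_0),\psi(\mathbf x_0)$ are jointly FO$^2(\tau)$-consistent, that is, if there are pointed structures $\mathfrak A,\mathbf a$ and $\mathfrak B,\mathbf b$ with $\mathfrak A\models\varphi(\mathbf a)$, $\mathfrak B\models\psi(\mathbf b)$ and $\mathfrak A,\mathbf a\sim_{\mathrm{FO}^2,\tau}\mathfrak B,\mathbf b$, then there are finite pointed structures $\mathfrak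 B_1,\mathbf b_1$ and $\mathfrak B_2,\mathbf b_2$ whose domains have at most double exponential size, namely at most $$2^{2^{C(|\varphi|+|\psi|)}}$$ elements each, such that $\mathfrak B_1\models\varphi(\mathbf b_1)$, $\mathfrak B_2\models\psi(\mathbf b_2)$ and $\mathfrak B_1,\mathbf b_1\sim_{\mathrm{FO}^2,\tau}\mathfrak B_2,\mathbf b_2$. -/

import Mathlib

universe u v w w'

namespace TwoVar

/-- A signature: a set of relation symbols (with their arities) of the relational language `L`. -/
abbrev Signature (L : FirstOrder.Language.{u, v}) : Type v := Set (Σ k : ℕ, L.Relations k)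

/-- Formulas of the two-variable fragment `FO²`: first-order formulas with equality over the
relation symbols of `L` in which only two variables (here the elements of `Fin 2`) are used,
free or bound, and may be requantified. -/
inductive Formula (L : FirstOrder.Language.{u, v}) : Type v
  | equal (x y : Fin 2) : Formula L
  | rel {k : ℕ} (R : L.Relations k) (xs : Fin k → Fin 2) : Formula L
  | neg (φ : Formula L) : Formula L
  | and (φ ψ : Formula L) : Formula L
  | or (φ ψ : Formula L) : Formula L
  | ex (x : Fin 2) (φ : Formula L) : Formula L
  | all (x : Fin 2) (φ : Formula L) : Formula L

namespace Formula

variable {L : FirstOrder.Language.{u, v}}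

/-- The free variables of a formula. -/
def freeVars : Formula L → Set (Fin 2)
  | equal x y => {x, y}
  | rel _ xs => Set.range xs
  | neg φ => φ.freeVars
  | and φ ψ => φ.freeVars ∪ ψ.freeVars
  | or φ ψ => φ.freeVars ∪ ψ.freeVars
  | ex x φ => φ.freeVars \ {x}
  | all x φ => φ.freeVars \ {x}

/-- The size of a formula: its number of occurrences of variables, relation symbols, equality
signs, connectives and quantifiers. -/
def size : Formula L → ℕ
  | equal _ _ => 3
  | rel (k := k) _ _ => k + 1
  | neg φ => φ.size + 1
  | and φ ψ => φ.size + ψ.size + 1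
  | or φ ψ => φ.size + ψ.size + 1
  | ex _ φ => φ.size + 2
  | all _ φ => φ.size + 2

/-- Truth of a formula in the structure `A` under the assignment `ν`. -/
def Realize {A : Type w} [L.Structure A] : Formula L → (Fin 2 → A) → Prop
  | equal x y, ν => ν x = ν y
  | rel R xs, ν => FirstOrder.Language.Structure.RelMap R (fun i => ν (xs i))
  | neg φ, ν => ¬ φ.Realize ν
  | and φ ψ, ν => φ.Realize ν ∧ ψ.Realize ν
  | or φ ψ, ν => φ.Realize ν ∨ ψ.Realize ν
  | ex x φ, ν => ∃ a : A, φ.Realize (Function.update ν x a)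
  | all x φ, ν => ∀ a : A, φ.Realize (Function.update ν x a)

/-- `A ⊨ φ(a)` for a tuple `x₀` of distinct variables and a tuple `a` of the same length. It is
used when the free variables of `φ` are among those of `x₀` and `A` is nonempty; the truth value
then does not depend on the choice of the assignment `ν` extending `x₀ ↦ a`. -/
def Holds {A : Type w} [L.Structure A] {n : ℕ} (φ : Formula L) (x₀ : Fin n ↪ Fin 2)
    (a : Fin n → A) : Prop :=
  ∃ ν : Fin 2 → A, (∀ i, ν (x₀ i) = a i) ∧ φ.Realize ν

end Formula

variable {L : FirstOrder.Language.{u, v}} {A : Type w} {B : Type w'} [L.Structure A] [L.Structure B]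

/-- `a ↦ b` is a partial `τ`-isomorphism: `a i ↦ b i` is a well-defined injective map between the
sets of components, and it preserves and reflects every relation of `τ` on all tuples of
components of `a` (these are the tuples `a ∘ f`). -/
def IsPartialIso (τ : Signature L) {n : ℕ} (a : Fin n → A) (b : Fin n → B) : Prop :=
  (∀ i j, a i = a j ↔ b i = b j) ∧
  ∀ (k : ℕ) (R : L.Relations k), (⟨k, R⟩ : Σ k : ℕ, L.Relations k) ∈ τ →
    ∀ f : Fin k → Fin n,
      FirstOrder.Language.Structure.RelMap R (fun i => a (f i)) ↔
        FirstOrder.Language.Structure.RelMap R (fun i => b (f i))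

/-- `S` is an `FO²(τ)`-bisimulation between `A` and `B`. -/
structure IsBisimulation (τ : Signature L) (S : A → B → Prop) : Prop where
  global_left : ∀ a : A, ∃ b : B, S a b
  global_right : ∀ b : B, ∃ a : A, S a b
  forth : ∀ a b, S a b → ∀ a' : A, ∃ b' : B, IsPartialIso τ ![a, a'] ![b, b'] ∧ S a' b'
  back : ∀ a b, S a b → ∀ b' : B, ∃ a' : A, IsPartialIso τ ![a, a'] ![b, b'] ∧ S a' b'

/-- `A, a ∼ B, b` with respect to `FO²(τ)`, for tuples of length `n` (used for `n ≤ 2`). -/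
def Bisimilar (τ : Signature L) {n : ℕ} (a : Fin n → A) (b : Fin n → B) : Prop :=
  IsPartialIso τ a b ∧ ∃ S : A → B → Prop, IsBisimulation τ S ∧ ∀ i, S (a i) (b i)

/-- `φ(x₀)` and `ψ(x₀)` are jointly `FO²(τ)`-consistent. -/
def JointlyConsistent (τ : Signature L) {n : ℕ} (x₀ : Fin n ↪ Fin 2) (φ ψ : Formula L) : Prop :=
  ∃ (A B : Type w) (_ : Nonempty A) (_ : Nonempty B) (_ : L.Structure A) (_ : L.Structure B)
    (a : Fin n → A) (b : Fin n → B),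
    φ.Holds x₀ a ∧ ψ.Holds x₀ b ∧ Bisimilar τ a b

end TwoVar

/-! ### Mosaics of bisimulation classes and links between copies -/

namespace Mosaic

variable {Z : Type*} {Q : Type*} {T : Type*} {D : Type}

/-! Form the disjoint union of the two structures and divide it by the equivalence relation
generated by the bisimulation. An element has a type (the relevant subformulas true at it, its side
and its marks), a class has a mosaic (the types it realizes), and a type together with a mosaic is a
key. There are exponentially many types and hence at most doubly exponentially many keys, although
there may be infinitely many classes.

The finite structures consist of copies `p` of chosen originals `o p`. The pair `(p, p')` imitates a
pair `(o₂ p p', o₂ p' p)` of distinct original elements, which need not be `(o p, o p')` but must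
have the same keys. Two copies are bisimilar when their originals lie in the same class. If neither
mosaic is unique, pairs from other classes with the same mosaics may be imitated. If one of them is,
the pair must come from the actual classes; and a king has only one copy, whose links imitate actual
pairs.

`exists_representatives` selects the originals, and `exists_links` assigns the patterns so that
every admissible demand is met, using three cyclic layers of copies as in the classical finite model
proof for FO². `exists_finite_unravelling` deduces from both that witnesses survive and that classes
remain homogeneous for the shared signature. Then `realize_patchwork` shows that such patterns
determine a structure with the right truth values, and `exists_finite_bisimulation` applies all this
to the two given structures. -/

theorem exists_finite_choice {I : Type*} [Finite I] (r : I → Z → Prop) :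
    ∃ X : Set Z, X.Finite ∧ X.ncard ≤ Nat.card I ∧
      (∀ i z, r i z → ∃ z' ∈ X, r i z') ∧ ∀ z ∈ X, ∃ i, r i z := by
  classical
  refine ⟨Set.range (fun i : {i // ∃ z, r i z} => i.2.choose), Set.finite_range _, ?_, ?_, ?_⟩
  · exact (Finite.card_range_le _).trans (Finite.card_subtype_le _)
  · intro i z h
    exact ⟨_, ⟨⟨i, z, h⟩, rfl⟩, Exists.choose_spec (⟨z, h⟩ : ∃ z, r i z)⟩
  · rintro _ ⟨i, rfl⟩
    exact ⟨i.1, i.2.choose_spec⟩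

/-- A well-order on `P` orients every unordered pair, so a pattern is chosen once per pair and read
backwards for the opposite orientation; symmetry of `W` makes both readings correct. -/
theorem exists_symmetric_choice {P : Type*} (W : P → P → Z → Z → Prop)
    (symm : ∀ p p' z z', W p p' z z' → W p' p z' z) (r : P → P → Prop)
    (hr : ∀ p p', r p p' → r p' p)
    (ex : ∀ p p', r p p' → ∃ z z', W p p' z z') (o : P → Z) :
    ∃ o₂ : P → P → Z, (∀ p, o₂ p p = o p) ∧
      ∀ p p', p ≠ p' → r p p' → W p p' (o₂ p p') (o₂ p' p) := by
  classical
  have ex' : ∀ p p', ∃ x : Z × Z, r p p' → W p p' x.1 x.2 := by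
    intro p p'
    by_cases h : r p p'
    · obtain ⟨z, z', hz⟩ := ex p p' h
      exact ⟨(z, z'), fun _ => hz⟩
    · exact ⟨(o p, o p), fun h' => absurd h' h⟩
  choose f hf using ex'
  refine ⟨fun p p' => if p = p' then o p else
    if WellOrderingRel p p' then (f p p').1 else (f p' p).2, fun p => by simp, ?_⟩
  intro p p' hne h
  rcases trichotomous_of WellOrderingRel p p' with hlt | heq | hlt
  · have hn : ¬ WellOrderingRel p' p := asymm_of _ hlt
    simpa [hne, hne.symm, hlt, hn] using hf p p' h
  · exact absurd heq hne
  · have hn : ¬ WellOrderingRel p p' := asymm_of _ hlt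
    simpa [hne, hne.symm, hlt, hn] using symm _ _ _ _ (hf p' p (hr _ _ h))

/-- The set of types realized in the class of `z`. -/
def mosaic (cls : Z → Q) (t : Z → T) (z : Z) : Set T := t '' {x | cls x = cls z}

/-- The type of `z` together with the mosaic of its class. -/
def key (cls : Z → Q) (t : Z → T) (z : Z) : T × Set T := (t z, mosaic cls t z)

/-- The class of `z` is the only one with its mosaic. -/
def IsUnique (cls : Z → Q) (t : Z → T) (z : Z) : Prop :=
  ∀ z', mosaic cls t z' = mosaic cls t z → cls z' = cls z

/-- No other element has the key of `z`. -/
def IsKing (cls : Z → Q) (t : Z → T) (z : Z) : Prop :=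
  ∀ z', key cls t z' = key cls t z → z' = z

/-- The pair `(z, z')` may serve as a pattern for the link between copies of `a` and of `a'`. -/
def Admissible (cls : Z → Q) (t : Z → T) (a a' z z' : Z) : Prop :=
  z ≠ z' ∧ key cls t z = key cls t a ∧ key cls t z' = key cls t a' ∧
    (IsUnique cls t a ∨ IsUnique cls t a' → cls z = cls a ∧ cls z' = cls a')

variable {cls : Z → Q} {t : Z → T}

theorem type_eq_of_key_eq {x y : Z} (h : key cls t x = key cls t y) : t x = t y :=
  congrArg Prod.fst h

theorem mosaic_eq_of_key_eq {x y : Z} (h : key cls t x = key cls t y) :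
    mosaic cls t x = mosaic cls t y :=
  congrArg Prod.snd h

theorem mosaic_eq_of_cls_eq {x y : Z} (h : cls x = cls y) : mosaic cls t x = mosaic cls t y := by
  simp [mosaic, h]

theorem key_eq {x y : Z} (h : t x = t y) (h' : mosaic cls t x = mosaic cls t y) :
    key cls t x = key cls t y :=
  Prod.ext h h'

theorem exists_of_mosaic_eq {x y z : Z} (h : mosaic cls t x = mosaic cls t y)
    (hz : cls z = cls x) : ∃ w, cls w = cls y ∧ t w = t z := by
  have : t z ∈ mosaic cls t y := h ▸ ⟨z, hz, rfl⟩
  exact this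

/-- A class with the same mosaic contains an element with the type, hence the key, of the king; that
element can only be the king. -/
theorem IsKing.isUnique {z : Z} (h : IsKing cls t z) : IsUnique cls t z := by
  intro z' hz'
  obtain ⟨w, hw, ht⟩ := exists_of_mosaic_eq hz'.symm (rfl : cls z = cls z)
  have := h w (key_eq ht ((mosaic_eq_of_cls_eq hw).trans hz'))
  rw [← hw, this]

theorem IsUnique.cls_eq {x y : Z} (h : IsUnique cls t y) (hk : key cls t x = key cls t y) :
    cls x = cls y :=
  h x (mosaic_eq_of_key_eq hk)

theorem IsUnique.of_mosaic_eq {x y : Z} (h : IsUnique cls t x)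
    (hk : mosaic cls t y = mosaic cls t x) : IsUnique cls t y := fun z hz =>
  (h z (hz.trans hk)).trans (h y hk).symm

theorem IsKing.of_key_eq {x y : Z} (h : IsKing cls t x) (hk : key cls t y = key cls t x) :
    IsKing cls t y := by
  rw [h y hk]; exact h

theorem Admissible.symm {a a' z z' : Z} (h : Admissible cls t a a' z z') :
    Admissible cls t a' a z' z :=
  ⟨h.1.symm, h.2.2.1, h.2.1, fun hu => (h.2.2.2 hu.symm).symm⟩

theorem Admissible.of_ne {a a' : Z} (h : a ≠ a') : Admissible cls t a a' a a' :=
  ⟨h, rfl, rfl, fun _ => ⟨rfl, rfl⟩⟩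

/-- The pair `(a, a')` itself works unless `a = a'`; then a second element with the same key is
needed, and failing to be a king supplies one. -/
theorem Admissible.exists_of_not_isKing {a a' : Z} (h : ¬ IsKing cls t a) :
    ∃ z z', Admissible cls t a a' z z' := by
  by_cases haa : a = a'
  · subst haa
    simp only [IsKing, not_forall] at h
    obtain ⟨z, hz, hne⟩ := h
    exact ⟨a, z, Ne.symm hne, rfl, hz, fun hu => ⟨rfl, (or_self_iff.1 hu).cls_eq hz⟩⟩
  · exact ⟨a, a', .of_ne haa⟩

/-- Finitely many copies of the elements of `X`, one for each king, can be linked in such a way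
that every admissible demand is met. -/
theorem exists_links [Finite D] [Nonempty Z] (π : Z → Z → D) (X : Set Z) (hX : X.Finite) :
    ∃ (P : Type) (o : P → Z) (o₂ : P → P → Z), Finite P ∧
      Nat.card P ≤ X.ncard * (Nat.card D * 3) ∧
      (∀ p, o p ∈ X) ∧ (∀ b ∈ X, ∃ p, o p = b) ∧ (∀ p, o₂ p p = o p) ∧
      (∀ p p', p ≠ p' → Admissible cls t (o p) (o p') (o₂ p p') (o₂ p' p)) ∧
      ∀ p, ∀ b ∈ X, ∀ z z', Admissible cls t (o p) b z z' →
        (IsKing cls t (o p) ∨ IsKing cls t b → z = o p ∧ z' = b) →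
        ∃ p', p' ≠ p ∧ o p' = b ∧ π (o₂ p p') (o₂ p' p) = π z z' := by
  classical
  obtain ⟨z₀⟩ := ‹Nonempty Z›
  have : Finite X := hX
  let e : Fin X.ncard ≃ X := (Finite.equivFin X).symm
  -- An arbitrary label, carried by the single copy of each king.
  let j₀ : D × Fin 3 := (π z₀ z₀, 0)
  let P := {x : Fin X.ncard × D × Fin 3 // IsKing cls t (e x.1) → x.2 = j₀}
  let o : P → Z := fun p => e p.1.1
  let d : P → D := fun p => p.1.2.1
  let i : P → Fin 3 := fun p => p.1.2.2
  -- Links of kings are actual pairs. Between non-kings, a copy in the layer following that of `p`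
  -- realizes its own label `d` as the pattern towards `p` whenever some admissible pair does; the
  -- last clause is the mirror image that makes `W` symmetric.
  let W : P → P → Z → Z → Prop := fun p p' z z' =>
    Admissible cls t (o p) (o p') z z' ∧
    (IsKing cls t (o p) ∨ IsKing cls t (o p') → z = o p ∧ z' = o p') ∧
    (¬ IsKing cls t (o p) → ¬ IsKing cls t (o p') → i p' = i p + 1 →
      (∃ w w', Admissible cls t (o p) (o p') w w' ∧ π w w' = d p') → π z z' = d p') ∧
    (¬ IsKing cls t (o p) → ¬ IsKing cls t (o p') → i p = i p' + 1 →
      (∃ w w', Admissible cls t (o p') (o p) w w' ∧ π w w' = d p) → π z' z = d p)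
  have hsymm : ∀ p p' z z', W p p' z z' → W p' p z' z := by
    rintro p p' z z' ⟨h1, h2, h3, h4⟩
    exact ⟨h1.symm, fun h => (h2 h.symm).symm, fun k k' => h4 k' k, fun k k' => h3 k' k⟩
  -- With three layers no two copies serve each other, so the last two clauses of `W` never compete.
  have hcyc : ∀ a b : Fin 3, a = b + 1 → b ≠ a + 1 := by decide
  have hking : ∀ p p', p ≠ p' → IsKing cls t (o p) → o p ≠ o p' := by
    intro p p' hne hk heq
    have hk' : IsKing cls t (o p') := heq ▸ hk
    exact hne (Subtype.ext (Prod.ext (e.injective (Subtype.ext heq)) ((p.2 hk).trans (p'.2 hk').symm)))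
  have hex : ∀ p p', p ≠ p' → ∃ z z', W p p' z z' := by
    intro p p' hne
    by_cases hk : IsKing cls t (o p) ∨ IsKing cls t (o p')
    · have hne' : o p ≠ o p' := by
        rcases hk with hk | hk
        · exact hking p p' hne hk
        · exact (hking p' p hne.symm hk).symm
      exact ⟨o p, o p', .of_ne hne', fun _ => ⟨rfl, rfl⟩,
        fun k k' => absurd hk (by tauto), fun k k' => absurd hk (by tauto)⟩
    · by_cases h1 : i p' = i p + 1 ∧ ∃ w w', Admissible cls t (o p) (o p') w w' ∧ π w w' = d p'
      · obtain ⟨hi, w, w', ha, hd⟩ := h1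
        exact ⟨w, w', ha, fun k => absurd k hk, fun _ _ _ _ => hd,
          fun _ _ hi' => absurd hi (hcyc _ _ hi')⟩
      by_cases h2 : i p = i p' + 1 ∧ ∃ w w', Admissible cls t (o p') (o p) w w' ∧ π w w' = d p
      · obtain ⟨hi, w, w', ha, hd⟩ := h2
        exact ⟨w', w, ha.symm, fun k => absurd k hk,
          fun _ _ hi' => absurd hi (hcyc _ _ hi'), fun _ _ _ _ => hd⟩
      obtain ⟨z, z', hz⟩ := Admissible.exists_of_not_isKing (a' := o p') (fun h => hk (Or.inl h))
      exact ⟨z, z', hz, fun k => absurd k hk, fun _ _ a b => absurd ⟨a, b⟩ h1,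
        fun _ _ a b => absurd ⟨a, b⟩ h2⟩
  obtain ⟨o₂, hdiag, ho₂⟩ := exists_symmetric_choice W hsymm (fun p p' => p ≠ p')
    (fun _ _ h => h.symm) hex o
  refine ⟨P, o, o₂, inferInstance, ?_, fun p => (e p.1.1).2, ?_, hdiag, fun p p' h => (ho₂ p p' h h).1, ?_⟩
  · refine (Finite.card_subtype_le _).trans ?_
    simp [Nat.card_prod, Set.ncard]
  · intro b hb
    exact ⟨⟨(e.symm ⟨b, hb⟩, j₀), fun _ => rfl⟩, by simp [o]⟩
  · intro p b hb z z' hadm hk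
    obtain ⟨y, rfl⟩ : ∃ y, (e y : Z) = b := ⟨e.symm ⟨b, hb⟩, by simp⟩
    by_cases hkk : IsKing cls t (o p) ∨ IsKing cls t (e y)
    · obtain ⟨rfl, rfl⟩ := hk hkk
      let p' : P := ⟨(y, j₀), fun _ => rfl⟩
      have hne : p ≠ p' := fun h => hadm.1 (congrArg o h)
      obtain ⟨h1, h2⟩ := (ho₂ p p' hne hne).2.1 hkk
      exact ⟨p', hne.symm, rfl, by rw [h1, h2]⟩
    -- The copy of `b` in the next layer, labelled with the demanded pattern.
    · let p' : P := ⟨(y, π z z', i p + 1), fun h => absurd (Or.inr h) hkk⟩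
      have hne : p ≠ p' := by
        intro h
        have h3 : ∀ a : Fin 3, a ≠ a + 1 := by decide
        exact h3 _ (congrArg i h)
      refine ⟨p', hne.symm, rfl, ?_⟩
      exact (ho₂ p p' hne hne).2.2.1 (fun h => hkk (Or.inl h)) (fun h => hkk (Or.inr h)) rfl
        ⟨z, z', hadm, rfl⟩

end Mosaic

/-! ### A bounded stock of originals, and the finite quotient -/

namespace Mosaic

variable {Z : Type*} {Q : Type*} {T : Type*} {D : Type} {cls : Z → Q} {t : Z → T}

theorem exists_representatives [Finite T] [Finite D] (cls : Z → Q) (t : Z → T) (π : Z → Z → D)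
    {K : ℕ} (hK : 2 ≤ K) (hD : Nat.card D ≤ K) (hT : Nat.card T ≤ K)
    (hkey : Nat.card (T × Set T) ≤ K) :
    ∃ X : Set Z, X.Finite ∧ X.ncard ≤ K ^ 11 ∧
      (∀ z, ∃ b ∈ X, key cls t b = key cls t z) ∧
      (∀ y ∈ X, ∀ z, cls z = cls y → ∃ b ∈ X, cls b = cls y ∧ t b = t z) ∧
      (∀ x, IsKing cls t x → ∀ y ∈ X, ∀ z, z ≠ x → cls z = cls y →
        ∃ b ∈ X, b ≠ x ∧ cls b = cls y ∧ t b = t z ∧ π x b = π x z) ∧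
      (∀ x ∈ X, IsUnique cls t x → ∀ z, z ≠ x → (IsKing cls t x ∨ ¬ IsUnique cls t z) →
        ∃ b ∈ X, b ≠ x ∧ key cls t b = key cls t z ∧ π x b = π x z) := by
  -- `R₀` represents all keys, and so contains every king. Two rounds of witnesses follow, `W₁` for
  -- `R₀` and `W₂` for `R₀ ∪ W₁`; `W₃` and `W₄` then work inside the finitely many classes already
  -- met, `W₃` realizing all their types and `W₄` all their patterns with kings.
  obtain ⟨R₀, fin₀, card₀, hR₀, -⟩ := exists_finite_choice
    (fun (k : T × Set T) z => key cls t z = k)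
  have key₀ : ∀ z, ∃ b ∈ R₀, key cls t b = key cls t z := fun z => hR₀ _ z rfl
  have witnesses : ∀ R : Set Z, R.Finite → ∃ R' : Set Z, R'.Finite ∧
      R'.ncard ≤ R.ncard * (K * K) ∧ ∀ x ∈ R, ∀ z, z ≠ x →
        ∃ b ∈ R', b ≠ x ∧ key cls t b = key cls t z ∧ π x b = π x z := by
    intro R hR
    have : Finite R := hR
    obtain ⟨R', fin', card', hR', -⟩ := exists_finite_choice
      (fun (i : R × D × (T × Set T)) (z : Z) => z ≠ i.1 ∧ key cls t z = i.2.2 ∧ π i.1 z = i.2.1)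
    refine ⟨R', fin', card'.trans ?_, fun x hx z hz =>
      hR' (⟨x, hx⟩, π x z, key cls t z) z ⟨hz, rfl, rfl⟩⟩
    rw [Nat.card_prod, Nat.card_prod, Nat.card_coe_set_eq]
    gcongr
  obtain ⟨W₁, finW₁, cardW₁, hW₁⟩ := witnesses R₀ fin₀
  have fin₁ : (R₀ ∪ W₁).Finite := fin₀.union finW₁
  obtain ⟨W₂, finW₂, cardW₂, hW₂⟩ := witnesses (R₀ ∪ W₁) fin₁
  have fin₂ : (R₀ ∪ W₁ ∪ W₂).Finite := fin₁.union finW₂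
  generalize hR₁ : R₀ ∪ W₁ = R₁ at *
  generalize hR₂ : R₁ ∪ W₂ = R₂ at *
  have : Finite R₂ := fin₂
  have : Finite R₀ := fin₀
  obtain ⟨W₃, finW₃, cardW₃, hW₃, subW₃⟩ := exists_finite_choice
    (fun (i : R₂ × T) z => cls z = cls i.1 ∧ t z = i.2)
  obtain ⟨W₄, finW₄, cardW₄, hW₄, subW₄⟩ := exists_finite_choice
    (fun (i : R₀ × R₂ × D × T) (z : Z) => z ≠ i.1 ∧ cls z = cls i.2.1 ∧ t z = i.2.2.2 ∧
      π i.1 z = i.2.2.1)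
  have h01 : R₀ ⊆ R₁ := hR₁ ▸ Set.subset_union_left
  have hw1 : W₁ ⊆ R₁ := hR₁ ▸ Set.subset_union_right
  have h12 : R₁ ⊆ R₂ := hR₂ ▸ Set.subset_union_left
  have hw2 : W₂ ⊆ R₂ := hR₂ ▸ Set.subset_union_right
  have hcls : ∀ z ∈ R₂ ∪ W₃ ∪ W₄, ∃ y ∈ R₂, cls z = cls y := by
    rintro z ((hz | hz) | hz)
    · exact ⟨z, hz, rfl⟩
    · obtain ⟨i, hi, -⟩ := subW₃ z hz
      exact ⟨i.1, i.1.2, hi⟩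
    · obtain ⟨i, -, hi, -⟩ := subW₄ z hz
      exact ⟨i.2.1, i.2.1.2, hi⟩
  have uniq : ∀ {x y : Z}, cls x = cls y → IsUnique cls t y → IsUnique cls t x :=
    fun h hu => hu.of_mosaic_eq (mosaic_eq_of_cls_eq h)
  have king₀ : ∀ x, IsKing cls t x → x ∈ R₀ := by
    intro x hx
    obtain ⟨b, hb, hk⟩ := key₀ x
    rwa [hx b hk] at hb
  -- Only elements of unique classes have demands for witnesses within the set. Keeping those in
  -- `R₁` alone stops the regress: the witnesses demanded lie in `W₁`, or lie in `W₂` and in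
  -- non-unique classes.
  refine ⟨{z ∈ R₂ ∪ W₃ ∪ W₄ | ¬ IsUnique cls t z ∨ z ∈ R₁},
    ((fin₂.union finW₃).union finW₄).subset (Set.sep_subset _ _), ?_, ?_, ?_, ?_, ?_⟩
  · refine (Set.ncard_le_ncard (Set.sep_subset _ _)
      ((fin₂.union finW₃).union finW₄)).trans ?_
    have c0 : R₀.ncard ≤ K := card₀.trans hkey
    have pw : ∀ {a b : ℕ}, a < b → 2 * K ^ a ≤ K ^ b := fun {a b} h =>
      calc 2 * K ^ a ≤ K * K ^ a := by gcongr
        _ = K ^ (a + 1) := by ring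
        _ ≤ K ^ b := Nat.pow_le_pow_right (by omega) h
    have c1 : R₁.ncard ≤ K ^ 4 := by
      have h1 := Set.ncard_union_le R₀ W₁
      rw [hR₁] at h1
      have h2 : W₁.ncard ≤ K ^ 3 := cardW₁.trans <| by
        calc _ ≤ K * (K * K) := by gcongr
          _ = _ := by ring
      have h3 : K ≤ K ^ 3 := Nat.le_self_pow (by norm_num) K
      have := pw (show 3 < 4 by norm_num)
      omega
    have c2 : R₂.ncard ≤ K ^ 7 := by
      have h1 := Set.ncard_union_le R₁ W₂
      rw [hR₂] at h1
      have h2 : W₂.ncard ≤ K ^ 6 := cardW₂.trans <| by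
        calc _ ≤ K ^ 4 * (K * K) := by gcongr
          _ = _ := by ring
      have h3 : K ^ 4 ≤ K ^ 6 := Nat.pow_le_pow_right (by omega) (by norm_num)
      have := pw (show 6 < 7 by norm_num)
      omega
    have c3 : W₃.ncard ≤ K ^ 8 := cardW₃.trans <| by
      rw [Nat.card_prod, Nat.card_coe_set_eq]
      calc _ ≤ K ^ 7 * K := by gcongr
        _ = _ := by ring
    have c4 : W₄.ncard ≤ K ^ 10 := cardW₄.trans <| by
      rw [Nat.card_prod, Nat.card_prod, Nat.card_prod, Nat.card_coe_set_eq, Nat.card_coe_set_eq]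
      calc _ ≤ K * (K ^ 7 * (K * K)) := by gcongr
        _ = _ := by ring
    have h1 := Set.ncard_union_le (R₂ ∪ W₃) W₄
    have h2 := Set.ncard_union_le R₂ W₃
    have h7 : K ^ 7 ≤ K ^ 8 := Nat.pow_le_pow_right (by omega) (by norm_num)
    have := pw (show 8 < 10 by norm_num)
    have := pw (show 10 < 11 by norm_num)
    omega
  · intro z
    obtain ⟨b, hb, hk⟩ := key₀ z
    exact ⟨b, ⟨Or.inl (Or.inl (h12 (h01 hb))), Or.inr (h01 hb)⟩, hk⟩
  · rintro y ⟨hy, -⟩ z hz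
    -- In a unique class the key representatives from `R₀` already realize every type; otherwise
    -- `W₃` does.
    by_cases hu : IsUnique cls t y
    · obtain ⟨b, hb, hk⟩ := key₀ z
      refine ⟨b, ⟨Or.inl (Or.inl (h12 (h01 hb))), Or.inr (h01 hb)⟩, ?_, type_eq_of_key_eq hk⟩
      exact ((uniq hz hu).cls_eq hk).trans hz
    · obtain ⟨y', hy', hyy'⟩ := hcls y hy
      obtain ⟨b, hb, h1, h2⟩ := hW₃ (⟨y', hy'⟩, t z) z ⟨hz.trans hyy', rfl⟩
      have h3 : cls b = cls y := h1.trans hyy'.symm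
      exact ⟨b, ⟨Or.inl (Or.inr hb), Or.inl fun h => hu (uniq h3.symm h)⟩, h3, h2⟩
  · rintro x hx y ⟨hy, -⟩ z hne hz
    by_cases hu : IsUnique cls t y
    · obtain ⟨b, hb, hbx, hk, hπ⟩ := hW₁ x (king₀ x hx) z hne
      refine ⟨b, ⟨Or.inl (Or.inl (h12 (hw1 hb))), Or.inr (hw1 hb)⟩, hbx, ?_,
        type_eq_of_key_eq hk, hπ⟩
      exact ((uniq hz hu).cls_eq hk).trans hz
    · obtain ⟨y', hy', hyy'⟩ := hcls y hy
      obtain ⟨b, hb, hbx, h1, h2, hπ⟩ := hW₄ (⟨x, king₀ x hx⟩, ⟨y', hy'⟩, π x z, t z) z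
        ⟨hne, hz.trans hyy', rfl, rfl⟩
      have h3 : cls b = cls y := h1.trans hyy'.symm
      exact ⟨b, ⟨Or.inr hb, Or.inl fun h => hu (uniq h3.symm h)⟩, hbx, h3, h2, hπ⟩
  · rintro x ⟨-, hx⟩ hu z hne hkz
    rcases hkz with hk | hz
    · obtain ⟨b, hb, h⟩ := hW₁ x (king₀ x hk) z hne
      exact ⟨b, ⟨Or.inl (Or.inl (h12 (hw1 hb))), Or.inr (hw1 hb)⟩, h⟩
    · obtain ⟨b, hb, h⟩ := hW₂ x (hx.resolve_left (not_not.2 hu)) z hne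
      exact ⟨b, ⟨Or.inl (Or.inl (hw2 hb)), Or.inl fun h' => hz
        (h'.of_mosaic_eq (mosaic_eq_of_key_eq h.2.1).symm)⟩, h⟩

/-- A finite quotient of a family of linked elements that preserves the types, the witnesses and
the homogeneity of the classes. -/
theorem exists_finite_unravelling [Finite T] [Finite D] [Nonempty Z] {E S : Type*}
    (side : Z → S) (cls : Z → Q) (t : Z → T) (π : Z → Z → D) (ρ : D → E)
    (hside : ∀ x y, t x = t y → side x = side y)
    (hom : ∀ x y, cls x = cls y → ∀ x', side x' = side x → x' ≠ x →
      ∃ y', side y' = side y ∧ y' ≠ y ∧ cls y' = cls x' ∧ ρ (π y y') = ρ (π x x'))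
    {K : ℕ} (hK : 2 ≤ K) (hD : Nat.card D ≤ K) (hT : Nat.card T ≤ K)
    (hkey : Nat.card (T × Set T) ≤ K) :
    ∃ (P : Type) (o : P → Z) (o₂ : P → P → Z), Finite P ∧ Nat.card P ≤ K ^ 14 ∧
      (∀ z, ∃ p, t (o p) = t z) ∧ (∀ p, o₂ p p = o p) ∧
      (∀ p p', p ≠ p' → t (o₂ p p') = t (o p) ∧ o₂ p p' ≠ o₂ p' p) ∧
      (∀ p z, side z = side (o p) → z ≠ o p →
        ∃ p', p' ≠ p ∧ t (o p') = t z ∧ π (o₂ p p') (o₂ p' p) = π (o p) z) ∧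
      ∀ p q, cls (o p) = cls (o q) → ∀ p', side (o p') = side (o p) → p' ≠ p →
        ∃ q', side (o q') = side (o q) ∧ q' ≠ q ∧ cls (o q') = cls (o p') ∧
          ρ (π (o₂ q q') (o₂ q' q)) = ρ (π (o₂ p p') (o₂ p' p)) := by
  obtain ⟨X, finX, cardX, hX₁, hX₂, hX₃, hX₄⟩ := exists_representatives cls t π hK hD hT hkey
  obtain ⟨P, o, o₂, finP, cardP, hoX, hXo, hdiag, hadm, hdem⟩ :=
    exists_links (cls := cls) (t := t) π X finX
  have uniq : ∀ {x y : Z}, mosaic cls t x = mosaic cls t y → IsUnique cls t y →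
      IsUnique cls t x := fun h hu => hu.of_mosaic_eq h
  refine ⟨P, o, o₂, finP, ?_, ?_, hdiag, ?_, ?_, ?_⟩
  · refine cardP.trans ?_
    calc _ ≤ K ^ 11 * (K * 3) := by gcongr
      _ ≤ K ^ 11 * (K * K ^ 2) := by gcongr; nlinarith
      _ = _ := by ring
  · intro z
    obtain ⟨b, hb, hk⟩ := hX₁ z
    obtain ⟨p, rfl⟩ := hXo b hb
    exact ⟨p, type_eq_of_key_eq hk⟩
  · intro p p' hne
    exact ⟨type_eq_of_key_eq (hadm p p' hne).2.1, (hadm p p' hne).1⟩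
  · intro p z _ hne
    -- it suffices to find a representative with the right key
    suffices h : ∃ b ∈ X, ∃ z', Admissible cls t (o p) b (o p) z' ∧
        (IsKing cls t (o p) ∨ IsKing cls t b → z' = b) ∧ t b = t z ∧ π (o p) z' = π (o p) z by
      obtain ⟨b, hb, z', ha, hk, ht, hπ⟩ := h
      obtain ⟨p', hp', rfl, hpπ⟩ := hdem p b hb (o p) z' ha (fun h => ⟨rfl, hk h⟩)
      exact ⟨p', hp', ht, hpπ.trans hπ⟩
    by_cases hkz : IsKing cls t z
    · obtain ⟨b, hb, hk⟩ := hX₁ z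
      obtain rfl := hkz b hk
      exact ⟨b, hb, b, .of_ne hne.symm, fun _ => rfl, rfl, rfl⟩
    -- Here a representative with the key of `z` could lie in the wrong class, or the king `o p`
    -- would require an actual pair, so the witness stored in `X` is used. In the remaining case `(o
    -- p, z)` itself is an admissible pattern.
    by_cases hu : IsUnique cls t (o p) ∧ (IsKing cls t (o p) ∨ ¬ IsUnique cls t z)
    · obtain ⟨b, hb, hbp, hk, hπ⟩ := hX₄ _ (hoX p) hu.1 z hne hu.2
      exact ⟨b, hb, b, .of_ne hbp.symm, fun _ => rfl, type_eq_of_key_eq hk, hπ⟩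
    · obtain ⟨b, hb, hk⟩ := hX₁ z
      have hnk : ¬ IsKing cls t (o p) := fun h => hu ⟨h.isUnique, Or.inl h⟩
      refine ⟨b, hb, z, ⟨hne.symm, rfl, hk.symm, fun h => ⟨rfl, ?_⟩⟩,
        fun h => ?_, type_eq_of_key_eq hk, rfl⟩
      · have hub : IsUnique cls t b := by
          rcases h with h | h
          · by_contra hb'
            exact hu ⟨h, Or.inr fun h' => hb' (uniq (mosaic_eq_of_key_eq hk) h')⟩
          · exact h
        exact hub.cls_eq hk.symm
      · exact absurd (h.resolve_left hnk) fun h' => hkz (h'.of_key_eq hk.symm)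
  · intro p q hpq p' hside' hne
    obtain ⟨hzz, hkz, hkz', huz⟩ := hadm p p' hne.symm
    have hsz : side (o₂ p' p) = side (o₂ p p') := by
      rw [hside _ _ (type_eq_of_key_eq hkz), hside _ _ (type_eq_of_key_eq hkz'), hside']
    generalize o₂ p p' = z at *
    generalize o₂ p' p = z' at *
    have hmq : mosaic cls t (o q) = mosaic cls t z :=
      (mosaic_eq_of_cls_eq hpq.symm).trans (mosaic_eq_of_key_eq hkz).symm
    suffices h : ∃ b ∈ X, ∃ y y', Admissible cls t (o q) b y y' ∧
        (IsKing cls t (o q) ∨ IsKing cls t b → y = o q ∧ y' = b) ∧ side y' = side y ∧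
        cls b = cls (o p') ∧ ρ (π y y') = ρ (π z z') by
      obtain ⟨b, hb, y, y', ha, hk, hs, hc, hπ⟩ := h
      obtain ⟨q', hq', rfl, hqπ⟩ := hdem q b hb y y' ha hk
      refine ⟨q', ?_, hq', hc, (congrArg ρ hqπ).trans hπ⟩
      rw [← hside _ _ (type_eq_of_key_eq ha.2.2.1), hs, hside _ _ (type_eq_of_key_eq ha.2.1)]
    -- The pattern comes from the actual classes, so homogeneity can be applied directly at `o q`.
    -- If `o q` is a king, the partner must itself belong to `X`; otherwise a representative `b` of
    -- its type in the same class suffices.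
    by_cases hu : IsUnique cls t (o p) ∨ IsUnique cls t (o p')
    · obtain ⟨hcz, hcz'⟩ := huz hu
      obtain ⟨y', hs, hy', hcy', hρ⟩ := hom z (o q) (hcz.trans hpq) z' hsz hzz.symm
      by_cases hkq : IsKing cls t (o q)
      · obtain ⟨b, hb, hbq, hcb, htb, hπb⟩ := hX₃ _ hkq (o p') (hoX p') y' hy'
          (hcy'.trans hcz')
        exact ⟨b, hb, o q, b, .of_ne hbq.symm, fun _ => ⟨rfl, rfl⟩,
          (hside _ _ htb).trans hs, hcb, (congrArg ρ hπb).trans hρ⟩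
      · obtain ⟨b, hb, hcb, htb⟩ := hX₂ (o p') (hoX p') y' (hcy'.trans hcz')
        have hyb : cls y' = cls b := (hcy'.trans hcz').trans hcb.symm
        have hkb : key cls t y' = key cls t b := key_eq htb.symm (mosaic_eq_of_cls_eq hyb)
        exact ⟨b, hb, o q, y', ⟨hy'.symm, rfl, hkb, fun _ => ⟨rfl, hyb⟩⟩,
          fun h => ⟨rfl, h.resolve_left hkq y' hkb⟩, hs, hcb, hρ⟩
    -- Without uniqueness, `o q` is replaced by an element `y` of its type in the class of `z`.
    -- Homogeneity gives a partner `y'` there, and equality of mosaics brings the type of `y'` back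
    -- to the class of `o p'`.
    · obtain ⟨y, hcy, hty⟩ := exists_of_mosaic_eq hmq (rfl : cls (o q) = cls (o q))
      obtain ⟨y', hs, hy', hcy', hρ⟩ := hom z y hcy.symm z' hsz hzz.symm
      have hm' : mosaic cls t y' = mosaic cls t (o p') :=
        (mosaic_eq_of_cls_eq hcy').trans (mosaic_eq_of_key_eq hkz')
      obtain ⟨x, hcx, htx⟩ := exists_of_mosaic_eq hm' (rfl : cls y' = cls y')
      obtain ⟨b, hb, hcb, htb⟩ := hX₂ (o p') (hoX p') x hcx
      have hnq : ¬ IsUnique cls t (o q) := fun h => hu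
        (Or.inl (uniq (mosaic_eq_of_cls_eq hpq) h))
      have hnb : ¬ IsUnique cls t b := fun h => hu
        (Or.inr (uniq (mosaic_eq_of_cls_eq hcb.symm) h))
      refine ⟨b, hb, y, y', ⟨hy'.symm, key_eq hty ((mosaic_eq_of_cls_eq hcy).trans hmq.symm),
        key_eq (htx.symm.trans htb.symm) (hm'.trans (mosaic_eq_of_cls_eq hcb.symm)),
        fun h => absurd h (not_or.2 ⟨hnq, hnb⟩)⟩,
        fun h => absurd h (not_or.2 ⟨fun h => hnq h.isUnique, fun h => hnb h.isUnique⟩),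
        hs, hcb, hρ⟩

end Mosaic

/-! ### Subformulas, and structures patched together from patterns -/

namespace TwoVar

namespace Formula

variable {L : FirstOrder.Language.{u, v}}

/-- The set of subformulas of a formula, including the formula itself. -/
def subformulas : Formula L → Set (Formula L)
  | equal x y => {equal x y}
  | rel R xs => {rel R xs}
  | neg φ => insert (neg φ) φ.subformulas
  | and φ ψ => insert (and φ ψ) (φ.subformulas ∪ ψ.subformulas)
  | or φ ψ => insert (or φ ψ) (φ.subformulas ∪ ψ.subformulas)
  | ex x φ => insert (ex x φ) φ.subformulas
  | all x φ => insert (all x φ) φ.subformulas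

theorem self_mem_subformulas (φ : Formula L) : φ ∈ φ.subformulas := by
  cases φ <;> simp [subformulas]

theorem finite_subformulas (φ : Formula L) : φ.subformulas.Finite := by
  induction φ with
  | equal | rel => exact Set.finite_singleton _
  | neg _ h | ex _ _ h | all _ _ h => exact h.insert _
  | and _ _ h h' | or _ _ h h' => exact (h.union h').insert _

theorem ncard_subformulas_le (φ : Formula L) : φ.subformulas.ncard ≤ φ.size := by
  induction φ with
  | equal | rel => simp [subformulas, size]
  | neg φ h | ex _ φ h | all _ φ h =>
    refine (Set.ncard_insert_le _ _).trans ?_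
    simp only [size]
    omega
  | and φ ψ h h' | or φ ψ h h' =>
    refine (Set.ncard_insert_le _ _).trans ?_
    have := Set.ncard_union_le φ.subformulas ψ.subformulas
    simp only [size]
    omega

theorem size_pos (φ : Formula L) : 0 < φ.size := by
  cases φ <;> simp [size]

theorem subformulas_subset {φ ψ : Formula L} (h : ψ ∈ φ.subformulas) :
    ψ.subformulas ⊆ φ.subformulas := by
  induction φ with
  | equal | rel => rw [Set.mem_singleton_iff.1 h]
  | neg _ ih | ex _ _ ih | all _ _ ih =>
    rcases h with rfl | h
    · exact subset_rfl
    · exact (ih h).trans (Set.subset_insert _ _)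
  | and _ _ ih ih' | or _ _ ih ih' =>
    rcases h with rfl | h | h
    · exact subset_rfl
    · exact (ih h).trans (Set.subset_union_left.trans (Set.subset_insert _ _))
    · exact (ih' h).trans (Set.subset_union_right.trans (Set.subset_insert _ _))

theorem realize_congr {A : Type w} [L.Structure A] (φ : Formula L) {ν ν' : Fin 2 → A}
    (h : ∀ x ∈ φ.freeVars, ν x = ν' x) : φ.Realize ν ↔ φ.Realize ν' := by
  induction φ generalizing ν ν' with
  | equal x y => simp [Realize, h x (by simp [freeVars]), h y (by simp [freeVars])]
  | rel R xs =>
    have : (fun i => ν (xs i)) = fun i => ν' (xs i) := funext fun i => h _ ⟨i, rfl⟩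
    simp [Realize, this]
  | neg φ ih => exact not_congr (ih h)
  | and φ ψ ih ih' =>
    exact and_congr (ih fun x hx => h x (Or.inl hx)) (ih' fun x hx => h x (Or.inr hx))
  | or φ ψ ih ih' =>
    exact or_congr (ih fun x hx => h x (Or.inl hx)) (ih' fun x hx => h x (Or.inr hx))
  | ex x φ ih | all x φ ih =>
    first
    | refine exists_congr fun a => ih fun y hy => ?_
    | refine forall_congr' fun a => ih fun y hy => ?_
    by_cases hxy : y = x
    · subst hxy; simp
    · simpa [hxy] using h y ⟨hy, hxy⟩

end Formula

variable {L : FirstOrder.Language.{u, v}}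

/-- A set of formulas closed under subformulas. -/
def SubformulaClosed (Φ : Set (Formula L)) : Prop := ∀ φ ∈ Φ, φ.subformulas ⊆ Φ

variable {A : Type w} {P : Type w'} [L.Structure A] {Φ : Set (Formula L)} {o : P → P → A}

open FirstOrder.Language.Structure (RelMap)

/-- The assignment in the pattern of the pair `(ν 0, ν 1)`. -/
def pattern (o : P → P → A) (ν : Fin 2 → P) : Fin 2 → A := fun i => o (ν i) (ν i.rev)

/-- The structure in which the atoms of `Φ` have the truth values given by the patterns `o`. -/
abbrev patchwork [L.IsRelational] (Φ : Set (Formula L)) (o : P → P → A) : L.Structure P where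
  RelMap {k} R xs := ∃ (ν : Fin 2 → P) (g : Fin k → Fin 2), Formula.rel R g ∈ Φ ∧
    xs = ν ∘ g ∧ RelMap R (pattern o ν ∘ g)

/-- The pairs `(o p p', o p' p)` serve as consistent patterns for the pairs `(p, p')`, and every
pair of distinct elements is the pattern of a pair with a given first component. -/
structure IsUnravelling (Φ : Set (Formula L)) (o : P → P → A) : Prop where
  type_eq : ∀ p p', ∀ χ ∈ Φ, χ.Realize (fun _ => o p p') ↔ χ.Realize fun _ => o p p
  ne : ∀ p p', p ≠ p' → o p p' ≠ o p' p
  witness : ∀ p z, z ≠ o p p → ∃ p', p' ≠ p ∧ ∀ χ ∈ Φ,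
    (χ.Realize ![o p p, z] ↔ χ.Realize ![o p p', o p' p]) ∧
    (χ.Realize ![z, o p p] ↔ χ.Realize ![o p' p, o p p'])

theorem Fin.eq_rev_of_ne {i j : Fin 2} (h : i ≠ j) : i.rev = j := by
  revert i j; decide

/-- This makes `patchwork` well defined. A tuple with two distinct entries determines the pattern of
each entry; for a constant tuple the patterns may differ, but only among elements of the same type.
-/
theorem IsUnravelling.relMap_pattern_congr (ho : IsUnravelling Φ o) {k : ℕ} {R : L.Relations k}
    {g g' : Fin k → Fin 2} (hg : Formula.rel R g ∈ Φ) {ν ν' : Fin 2 → P}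
    (h : ν ∘ g = ν' ∘ g') (hr : RelMap R (pattern o ν ∘ g)) : RelMap R (pattern o ν' ∘ g') := by
  have h' : ∀ i, ν (g i) = ν' (g' i) := congrFun h
  by_cases hc : ∀ i j, ν (g i) = ν (g j)
  · cases k with
    | zero => exact Subsingleton.elim (pattern o ν ∘ g) (pattern o ν' ∘ g') ▸ hr
    | succ k =>
      have key : ∀ (ν : Fin 2 → P) (g : Fin (k + 1) → Fin 2) (p : P), (∀ i, ν (g i) = p) →
          ∃ q, pattern o ν ∘ g = fun _ => o p q := by
        intro ν g p hp
        refine ⟨ν (g 0).rev, funext fun i => ?_⟩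
        simp only [Function.comp, pattern, hp]
        by_cases hi : g i = g 0
        · rw [hi]
        · rw [Fin.eq_rev_of_ne hi, Fin.eq_rev_of_ne (Ne.symm hi), hp, hp]
      obtain ⟨q, hq⟩ := key ν g (ν (g 0)) fun i => hc i 0
      obtain ⟨q', hq'⟩ := key ν' g' (ν (g 0)) fun i => by rw [← h', hc i 0]
      rw [hq] at hr
      rw [hq']
      exact (ho.type_eq _ q' _ hg).2 ((ho.type_eq _ q _ hg).1 hr)
  · have : pattern o ν ∘ g = pattern o ν' ∘ g' := by
      funext i
      obtain ⟨j, hj⟩ : ∃ j, ν (g i) ≠ ν (g j) := by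
        by_contra! hcon
        exact hc fun a b => (hcon a).symm.trans (hcon b)
      have hj' : ν' (g' i) ≠ ν' (g' j) := by rwa [← h', ← h']
      simp only [Function.comp, pattern, Fin.eq_rev_of_ne (fun e => hj (congrArg ν e)),
        Fin.eq_rev_of_ne (fun e => hj' (congrArg ν' e)), h']
    rwa [← this]

theorem IsUnravelling.realize_pattern_comp (ho : IsUnravelling Φ o) {χ : Formula L} (hχ : χ ∈ Φ)
    (ν : Fin 2 → P) (h : Fin 2 → Fin 2) :
    χ.Realize (pattern o (ν ∘ h)) ↔ χ.Realize (pattern o ν ∘ h) := by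
  by_cases hh : h 0 = h 1
  · have h0 : ∀ i, h i = h 0 := Fin.forall_fin_two.2 ⟨rfl, hh.symm⟩
    have h1 : pattern o (ν ∘ h) = fun _ => o (ν (h 0)) (ν (h 0)) := by
      funext i; simp [pattern, h0]
    have h2 : pattern o ν ∘ h = fun _ => o (ν (h 0)) (ν (h 0).rev) := by
      funext i; simp [pattern, h0 i]
    rw [h1, h2, ho.type_eq _ (ν (h 0).rev) _ hχ]
  · have h0 : ∀ i : Fin 2, h i.rev = (h i).rev :=
      Fin.forall_fin_two.2 ⟨(Fin.eq_rev_of_ne hh).symm, (Fin.eq_rev_of_ne (Ne.symm hh)).symm⟩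
    have h1 : pattern o (ν ∘ h) = pattern o ν ∘ h := by
      funext i; simp [pattern, h0]
    rw [h1]

/-- With at most one free variable, the truth value depends only on the type, which is the same in
all patterns of that element. This is what handles quantified formulas, whose bound variable is no
longer free. -/
theorem IsUnravelling.realize_pattern_of_independent (ho : IsUnravelling Φ o) {ψ : Formula L}
    (hψ : ψ ∈ Φ) {x : Fin 2} (hx : x ∉ ψ.freeVars) (ν : Fin 2 → P) :
    ψ.Realize (pattern o ν) ↔ ψ.Realize fun _ => o (ν x.rev) (ν x.rev) := by
  rw [← ho.type_eq _ (ν x) ψ hψ]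
  refine ψ.realize_congr fun y hy => ?_
  have hxy : x ≠ y := fun h => hx (h ▸ hy)
  rw [pattern, Fin.eq_rev_of_ne hxy, Fin.eq_rev_of_ne hxy.symm]

theorem IsUnravelling.exists_witness (ho : IsUnravelling Φ o) (ν : Fin 2 → P) (x : Fin 2) (z : A) :
    ∃ p, ∀ χ ∈ Φ, χ.Realize (Function.update (fun _ => o (ν x.rev) (ν x.rev)) x z) ↔
      χ.Realize (pattern o (Function.update ν x p)) := by
  have hpat : ∀ p : P, pattern o (Function.update ν x p) =
      Function.update (fun _ => o (ν x.rev) p) x (o p (ν x.rev)) := by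
    intro p; funext i; revert i x; simp [Fin.forall_fin_two, pattern]
  by_cases hz : z = o (ν x.rev) (ν x.rev)
  · subst hz
    exact ⟨ν x.rev, fun χ _ => by rw [hpat]⟩
  · obtain ⟨p, -, hp⟩ := ho.witness (ν x.rev) z hz
    refine ⟨p, fun χ hχ => ?_⟩
    have hup : ∀ a b : A, Function.update (fun _ => a) (0 : Fin 2) b = ![b, a] ∧
        Function.update (fun _ => a) (1 : Fin 2) b = ![a, b] := by
      intro a b
      constructor <;> funext i <;> revert i <;> simp [Fin.forall_fin_two]
    rw [hpat]
    revert x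
    simp only [Fin.forall_fin_two, hup]
    exact ⟨fun _ _ h => (h χ hχ).2, fun _ _ h => (h χ hχ).1⟩

section Patchwork

variable [L.IsRelational]

theorem IsUnravelling.relMap_patchwork (ho : IsUnravelling Φ o) {k : ℕ} {R : L.Relations k}
    {g : Fin k → Fin 2} (hg : Formula.rel R g ∈ Φ) (ν : Fin 2 → P) :
    (patchwork Φ o).RelMap R (ν ∘ g) ↔ RelMap R (pattern o ν ∘ g) :=
  ⟨fun ⟨_, _, hg', h, hr⟩ => ho.relMap_pattern_congr hg' h.symm hr, fun hr => ⟨ν, g, hg, rfl, hr⟩⟩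

/-- The atom for `g` need not belong to `Φ`, so its truth value is expressed through atoms of `Φ`
with renamed variables. This is why patterns are later recorded under all renamings. -/
theorem IsUnravelling.relMap_patchwork_of_ne (ho : IsUnravelling Φ o) {k : ℕ} (R : L.Relations k)
    (g : Fin k → Fin 2) {p p' : P} (hp : p ≠ p') :
    (patchwork Φ o).RelMap R (![p, p'] ∘ g) ↔ ∃ (g₀ : Fin k → Fin 2) (h : Fin 2 → Fin 2),
      Formula.rel R g₀ ∈ Φ ∧ g = h ∘ g₀ ∧
        (Formula.rel R g₀).Realize (![o p p', o p' p] ∘ h) := by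
  have hpat : pattern o ![p, p'] = ![o p p', o p' p] := by
    funext i; fin_cases i <;> rfl
  have hinj : Function.Injective ![p, p'] := by
    intro i j; fin_cases i <;> fin_cases j <;> simp [hp, hp.symm]
  rw [← hpat]
  constructor
  · rintro ⟨ν, g₀, hg₀, hν, hr⟩
    have hfac : Function.FactorsThrough g g₀ := by
      intro i j hij
      apply hinj
      have h1 := congrFun hν i
      have h2 := congrFun hν j
      simp only [Function.comp] at h1 h2
      rw [h1, h2, hij]
    obtain ⟨h, hh⟩ := (Function.factorsThrough_iff g).1 hfac
    refine ⟨g₀, h, hg₀, hh, (ho.realize_pattern_comp hg₀ _ h).1 ?_⟩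
    refine ho.relMap_pattern_congr hg₀ ?_ hr
    rw [← hν, hh]; rfl
  · rintro ⟨g₀, h, hg₀, rfl, hr⟩
    exact ⟨![p, p'] ∘ h, g₀, hg₀, rfl, (ho.realize_pattern_comp hg₀ _ h).2 hr⟩

theorem IsUnravelling.relMap_patchwork_const (ho : IsUnravelling Φ o) {k : ℕ} (R : L.Relations k)
    (p : P) :
    (patchwork Φ o).RelMap R (fun _ => p) ↔ ∃ g₀ : Fin k → Fin 2,
      Formula.rel R g₀ ∈ Φ ∧ (Formula.rel R g₀).Realize (fun _ => o p p) := by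
  constructor
  · rintro ⟨ν, g₀, hg₀, hν, hr⟩
    exact ⟨g₀, hg₀, ho.relMap_pattern_congr (ν' := fun _ => p) (g' := g₀) hg₀ hν.symm hr⟩
  · rintro ⟨g₀, hg₀, hr⟩
    exact ⟨fun _ => p, g₀, hg₀, rfl, hr⟩

/-- Formulas of `Φ` have the same truth values in the patchwork as in the patterns. -/
theorem IsUnravelling.realize_patchwork (ho : IsUnravelling Φ o) (hΦ : SubformulaClosed Φ)
    (χ : Formula L) (hχ : χ ∈ Φ) (ν : Fin 2 → P) :
    @Formula.Realize L P (patchwork Φ o) χ ν ↔ χ.Realize (pattern o ν) := by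
  have hsub := hΦ χ hχ
  induction χ generalizing ν with
  | equal x y =>
    by_cases h : ν x = ν y
    · by_cases hxy : x = y
      · simp [Formula.Realize, hxy]
      · simp [Formula.Realize, h, pattern, Fin.eq_rev_of_ne hxy, Fin.eq_rev_of_ne (Ne.symm hxy)]
    · have hxy : x ≠ y := fun e => h (e ▸ rfl)
      have := ho.ne _ _ h
      simpa [Formula.Realize, h, pattern, Fin.eq_rev_of_ne hxy, Fin.eq_rev_of_ne hxy.symm]
  | rel R g => exact ho.relMap_patchwork hχ ν
  | neg φ ih =>
    have h := hsub (Set.mem_insert_of_mem _ φ.self_mem_subformulas)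
    exact not_congr (ih h ν (hΦ _ h))
  | and φ ψ ih ih' =>
    have h := hsub (Set.mem_insert_of_mem _ (Or.inl φ.self_mem_subformulas))
    have h' := hsub (Set.mem_insert_of_mem _ (Or.inr ψ.self_mem_subformulas))
    exact and_congr (ih h ν (hΦ _ h)) (ih' h' ν (hΦ _ h'))
  | or φ ψ ih ih' =>
    have h := hsub (Set.mem_insert_of_mem _ (Or.inl φ.self_mem_subformulas))
    have h' := hsub (Set.mem_insert_of_mem _ (Or.inr ψ.self_mem_subformulas))
    exact or_congr (ih h ν (hΦ _ h)) (ih' h' ν (hΦ _ h'))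
  | ex x φ ih =>
    have h := hsub (Set.mem_insert_of_mem _ φ.self_mem_subformulas)
    have hx : x ∉ (Formula.ex x φ).freeVars := fun h => h.2 rfl
    have hne : x.rev ≠ x := (by decide : ∀ y : Fin 2, y.rev ≠ y) x
    constructor
    · rintro ⟨p, hp⟩
      replace hp := (ih h _ (hΦ _ h)).1 hp
      -- The quantified formula holds in the pattern of the pair containing the witness, and it is
      -- carried to the pattern of `ν` through the element that both pairs share.
      have : (Formula.ex x φ).Realize (pattern o (Function.update ν x p)) :=
        ⟨_, by rwa [Function.update_eq_self]⟩
      rw [ho.realize_pattern_of_independent hχ hx] at this ⊢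
      rwa [Function.update_of_ne hne] at this
    · intro hp
      rw [ho.realize_pattern_of_independent hχ hx] at hp
      obtain ⟨z, hz⟩ := hp
      obtain ⟨p, hp⟩ := ho.exists_witness ν x z
      exact ⟨p, (ih h _ (hΦ _ h)).2 ((hp φ h).1 hz)⟩
  | all x φ ih =>
    have h := hsub (Set.mem_insert_of_mem _ φ.self_mem_subformulas)
    have hx : x ∉ (Formula.all x φ).freeVars := fun h => h.2 rfl
    have hne : x.rev ≠ x := (by decide : ∀ y : Fin 2, y.rev ≠ y) x
    constructor
    · intro hp
      rw [ho.realize_pattern_of_independent hχ hx]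
      intro z
      obtain ⟨p, hpz⟩ := ho.exists_witness ν x z
      exact (hpz φ h).2 ((ih h _ (hΦ _ h)).1 (hp p))
    · intro hp p
      refine (ih h _ (hΦ _ h)).2 ?_
      rw [ho.realize_pattern_of_independent hχ hx] at hp
      have : (Formula.all x φ).Realize (pattern o (Function.update ν x p)) := by
        rwa [ho.realize_pattern_of_independent hχ hx, Function.update_of_ne hne]
      simpa using this (pattern o (Function.update ν x p) x)

end Patchwork

end TwoVar

/-! ### Partial isomorphisms and the finite bisimulation -/

namespace TwoVar

open FirstOrder.Language.Structure (RelMap)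

variable {L : FirstOrder.Language.{u, v}} {τ : Signature L}

section PartialIso

variable {A B C : Type*} [L.Structure A] [L.Structure B] [L.Structure C]

theorem IsPartialIso.refl (τ : Signature L) {n : ℕ} (a : Fin n → A) : IsPartialIso τ a a :=
  ⟨fun _ _ => Iff.rfl, fun _ _ _ _ => Iff.rfl⟩

theorem IsPartialIso.symm {n : ℕ} {a : Fin n → A} {b : Fin n → B} (h : IsPartialIso τ a b) :
    IsPartialIso τ b a :=
  ⟨fun i j => (h.1 i j).symm, fun k R hR f => (h.2 k R hR f).symm⟩

theorem IsPartialIso.trans {n : ℕ} {a : Fin n → A} {b : Fin n → B} {c : Fin n → C}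
    (h : IsPartialIso τ a b) (h' : IsPartialIso τ b c) : IsPartialIso τ a c :=
  ⟨fun i j => (h.1 i j).trans (h'.1 i j), fun k R hR f => (h.2 k R hR f).trans (h'.2 k R hR f)⟩

theorem IsPartialIso.comp {m n : ℕ} {a : Fin n → A} {b : Fin n → B} (h : IsPartialIso τ a b)
    (f : Fin m → Fin n) : IsPartialIso τ (a ∘ f) (b ∘ f) :=
  ⟨fun _ _ => h.1 _ _, fun k R hR g => h.2 k R hR (f ∘ g)⟩

theorem IsPartialIso.realize_rel_iff {a : Fin 2 → A} {b : Fin 2 → B} (h : IsPartialIso τ a b)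
    {k : ℕ} {R : L.Relations k} (hR : (⟨k, R⟩ : Σ k : ℕ, L.Relations k) ∈ τ) (g : Fin k → Fin 2)
    (f : Fin 2 → Fin 2) :
    (Formula.rel R g).Realize (a ∘ f) ↔ (Formula.rel R g).Realize (b ∘ f) :=
  h.2 k R hR (f ∘ g)

theorem isPartialIso_pair {a a' : A} {b b' : B} (h : a = a' ↔ b = b')
    (h' : ∀ (k : ℕ) (R : L.Relations k), (⟨k, R⟩ : Σ k : ℕ, L.Relations k) ∈ τ →
      ∀ f : Fin k → Fin 2, RelMap R (![a, a'] ∘ f) ↔ RelMap R (![b, b'] ∘ f)) :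
    IsPartialIso τ ![a, a'] ![b, b'] := by
  refine ⟨?_, h'⟩
  simp [Fin.forall_fin_two, h, eq_comm (a := a'), eq_comm (a := b')]

theorem IsPartialIso.pair_eq_iff {a a' : A} {b b' : B} (h : IsPartialIso τ ![a, a'] ![b, b']) :
    a = a' ↔ b = b' :=
  h.1 0 1

end PartialIso

/-- Both patchworks use the same `Φ`, so relations on pairs are computed by the same rule from the
`τ`-atoms of `Φ`; agreement on these therefore gives agreement on all of `τ`. -/
theorem IsUnravelling.isPartialIso_patchwork [L.IsRelational] {A A' P P' : Type*} [L.Structure A]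
    [L.Structure A'] {Φ : Set (Formula L)} {o : P → P → A} {o' : P' → P' → A'}
    (ho : IsUnravelling Φ o) (ho' : IsUnravelling Φ o') {p p' : P} {q q' : P'}
    (heq : p = p' ↔ q = q')
    (h₁ : ∀ (k : ℕ) (R : L.Relations k) (g : Fin k → Fin 2),
      (⟨k, R⟩ : Σ k : ℕ, L.Relations k) ∈ τ → Formula.rel R g ∈ Φ →
      ((Formula.rel R g).Realize (fun _ => o p p) ↔ (Formula.rel R g).Realize fun _ => o' q q))
    (h₂ : p ≠ p' → ∀ (k : ℕ) (R : L.Relations k) (g : Fin k → Fin 2),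
      (⟨k, R⟩ : Σ k : ℕ, L.Relations k) ∈ τ → Formula.rel R g ∈ Φ → ∀ h : Fin 2 → Fin 2,
      ((Formula.rel R g).Realize (![o p p', o p' p] ∘ h) ↔
        (Formula.rel R g).Realize (![o' q q', o' q' q] ∘ h))) :
    @IsPartialIso L P P' (patchwork Φ o) (patchwork Φ o') τ 2 ![p, p'] ![q, q'] := by
  let _ := patchwork Φ o
  let _ := patchwork Φ o'
  refine isPartialIso_pair heq fun k R hR f => ?_
  by_cases hp : p = p'
  · obtain rfl := heq.1 hp
    subst hp
    have hc : ∀ {X : Type _} (x : X), ![x, x] ∘ f = fun _ => x := by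
      intro X x; funext i
      exact (Fin.forall_fin_two.2 ⟨rfl, rfl⟩ : ∀ j, ![x, x] j = x) (f i)
    have hc' : ![q, q] ∘ f = fun _ => q := by
      funext i
      exact (Fin.forall_fin_two.2 ⟨rfl, rfl⟩ : ∀ j, ![q, q] j = q) (f i)
    rw [hc, hc']
    refine (ho.relMap_patchwork_const R p).trans (Iff.trans ?_ (ho'.relMap_patchwork_const R q).symm)
    exact exists_congr fun g => and_congr_right fun hg => h₁ k R g hR hg
  · refine (ho.relMap_patchwork_of_ne R f hp).trans
      (Iff.trans ?_ (ho'.relMap_patchwork_of_ne R f (fun h => hp (heq.2 h))).symm)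
    exact exists_congr fun g => exists_congr fun h => and_congr_right fun hg =>
      and_congr_right fun _ => h₂ hp k R g hR hg h

section Family

variable {F : Bool → Type w} [∀ b, L.Structure (F b)] {Φ : Set (Formula L)}

/-- The formulas of `Φ` that hold at `(z, z')` after renaming the variables. -/
def truths (Φ : Set (Formula L)) (z z' : Σ b, F b) (h : Fin 2 → Fin 2) : Set Φ :=
  {χ | ∃ (b : Bool) (ν : Fin 2 → F b), (∀ i, (⟨b, ν i⟩ : Σ b, F b) = ![z, z'] (h i)) ∧
    χ.1.Realize ν}

/-- The part of a truth assignment that concerns the atoms over `τ`. -/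
def restrictTo (τ : Signature L) (d : (Fin 2 → Fin 2) → Set Φ) (h : Fin 2 → Fin 2) : Set Φ :=
  {χ ∈ d h | ∃ (k : ℕ) (R : L.Relations k) (g : Fin k → Fin 2),
    (⟨k, R⟩ : Σ k : ℕ, L.Relations k) ∈ τ ∧ χ.1 = Formula.rel R g}

theorem mem_truths {b : Bool} {x x' : F b} {h : Fin 2 → Fin 2} {χ : Φ} :
    χ ∈ truths Φ (⟨b, x⟩ : Σ b, F b) ⟨b, x'⟩ h ↔ χ.1.Realize (![x, x'] ∘ h) := by
  have hx : ∀ i, ![(⟨b, x⟩ : Σ b, F b), ⟨b, x'⟩] i = ⟨b, ![x, x'] i⟩ :=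
    Fin.forall_fin_two.2 ⟨rfl, rfl⟩
  constructor
  · rintro ⟨c, ν, hν, hr⟩
    obtain rfl : c = b := (congrArg Sigma.fst (hν 0)).trans (by rw [hx])
    have : ν = ![x, x'] ∘ h := funext fun i => by
      have := hν i
      rw [hx] at this
      exact eq_of_heq (Sigma.mk.inj this).2
    rwa [← this]
  · intro hr
    exact ⟨b, _, fun i => (hx _).symm, hr⟩

theorem restrictTo_truths_eq {b b' : Bool} {x x' : F b} {y y' : F b'}
    (h : IsPartialIso τ ![x, x'] ![y, y']) :
    restrictTo τ (truths Φ (⟨b, x⟩ : Σ b, F b) ⟨b, x'⟩) =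
      restrictTo τ (truths Φ (⟨b', y⟩ : Σ b, F b) ⟨b', y'⟩) := by
  funext f
  ext ⟨χ, hχ⟩
  refine and_congr_left ?_
  rintro ⟨k, R, g, hR, rfl⟩
  rw [mem_truths, mem_truths]
  exact h.realize_rel_iff hR g f

theorem realize_iff_of_restrictTo_eq {b b' : Bool} {x x' : F b} {y y' : F b'}
    (h : restrictTo τ (truths Φ (⟨b, x⟩ : Σ b, F b) ⟨b, x'⟩) =
      restrictTo τ (truths Φ (⟨b', y⟩ : Σ b, F b) ⟨b', y'⟩))
    {k : ℕ} {R : L.Relations k} (hR : (⟨k, R⟩ : Σ k : ℕ, L.Relations k) ∈ τ)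
    {g : Fin k → Fin 2} (hg : Formula.rel R g ∈ Φ) (f : Fin 2 → Fin 2) :
    (Formula.rel R g).Realize (![x, x'] ∘ f) ↔ (Formula.rel R g).Realize (![y, y'] ∘ f) := by
  have h1 : (⟨_, hg⟩ : Φ) ∈ restrictTo τ (truths Φ (⟨b, x⟩ : Σ b, F b) ⟨b, x'⟩) f ↔
      (⟨_, hg⟩ : Φ) ∈ restrictTo τ (truths Φ (⟨b', y⟩ : Σ b, F b) ⟨b', y'⟩) f := by rw [h]
  have hτ : ∃ (k' : ℕ) (R' : L.Relations k') (g' : Fin k' → Fin 2),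
    (⟨k', R'⟩ : Σ k : ℕ, L.Relations k) ∈ τ ∧ Formula.rel R g = Formula.rel R' g' :=
    ⟨k, R, g, hR, rfl⟩
  rw [← mem_truths (χ := (⟨_, hg⟩ : Φ)), ← mem_truths (χ := (⟨_, hg⟩ : Φ))]
  exact ⟨fun h => (h1.1 ⟨h, hτ⟩).1, fun h => (h1.2 ⟨h, hτ⟩).1⟩

/-- The relation `S` on the disjoint union. -/
def Linked (S : F true → F false → Prop) (z z' : Σ b, F b) : Prop :=
  ∃ a b, z = ⟨true, a⟩ ∧ z' = ⟨false, b⟩ ∧ S a b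

/-- Back-and-forth steps compose along chains of links. Both directions are carried at once so that
the induction passes through symmetry; the related elements may then lie on the same side. -/
theorem IsBisimulation.exists_of_eqvGen {S : F true → F false → Prop} (hS : IsBisimulation τ S)
    {z y : Σ b, F b} (h : Relation.EqvGen (Linked S) z y) :
    (∀ x : F z.1, ∃ x' : F y.1, Relation.EqvGen (Linked S) ⟨z.1, x⟩ ⟨y.1, x'⟩ ∧
      IsPartialIso τ ![z.2, x] ![y.2, x']) ∧
    (∀ x : F y.1, ∃ x' : F z.1, Relation.EqvGen (Linked S) ⟨y.1, x⟩ ⟨z.1, x'⟩ ∧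
      IsPartialIso τ ![y.2, x] ![z.2, x']) := by
  induction h with
  | rel z y h =>
    obtain ⟨a, b, rfl, rfl, hab⟩ := h
    constructor
    · intro x
      obtain ⟨x', hi, hs⟩ := hS.forth a b hab x
      exact ⟨x', .rel _ _ ⟨x, x', rfl, rfl, hs⟩, hi⟩
    · intro x
      obtain ⟨x', hi, hs⟩ := hS.back a b hab x
      exact ⟨x', .symm _ _ (.rel _ _ ⟨x', x, rfl, rfl, hs⟩), hi.symm⟩
  | refl z => exact ⟨fun x => ⟨x, .refl _, .refl _ _⟩, fun x => ⟨x, .refl _, .refl _ _⟩⟩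
  | symm _ _ _ ih => exact ih.symm
  | trans x y z _ _ ih ih' =>
    constructor
    · intro w
      obtain ⟨w₁, h1, h2⟩ := ih.1 w
      obtain ⟨w₂, h3, h4⟩ := ih'.1 w₁
      exact ⟨w₂, .trans _ _ _ h1 h3, h2.trans h4⟩
    · intro w
      obtain ⟨w₁, h1, h2⟩ := ih'.2 w
      obtain ⟨w₂, h3, h4⟩ := ih.2 w₁
      exact ⟨w₂, .trans _ _ _ h1 h3, h2.trans h4⟩

/-- A bisimulation between two structures can be replaced by one between finite structures with
the same truth values of the formulas of `Φ` at two distinguished elements of each structure. -/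
theorem exists_finite_bisimulation [L.IsRelational] {S : F true → F false → Prop}
    (hS : IsBisimulation τ S) (hΦ : SubformulaClosed Φ) (finΦ : Φ.Finite)
    (μ : ∀ b, Fin 2 → F b) (hμ : ∀ i, S (μ true i) (μ false i))
    (hiso : IsPartialIso τ (μ true) (μ false)) {K : ℕ} (hK : 2 ≤ K)
    (hD : Nat.card ((Fin 2 → Fin 2) → Set Φ) ≤ K)
    (hT : Nat.card (Set Φ × Set (Fin 2) × Bool) ≤ K)
    (hkey : Nat.card ((Set Φ × Set (Fin 2) × Bool) × Set (Set Φ × Set (Fin 2) × Bool)) ≤ K) :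
    ∃ (G : Bool → Type w') (_ : ∀ b, L.Structure (G b)) (ν : ∀ b, Fin 2 → G b)
      (S' : G true → G false → Prop), (∀ b, Finite (G b)) ∧ (∀ b, Nat.card (G b) ≤ K ^ 14) ∧
      (∀ b, ∀ χ ∈ Φ, χ.Realize (ν b) ↔ χ.Realize (μ b)) ∧
      IsPartialIso τ (ν true) (ν false) ∧ IsBisimulation τ S' ∧
      ∀ i, S' (ν true i) (ν false i) := by
  have : Finite Φ := finΦ
  let Z := Σ b, F b
  have : Nonempty Z := ⟨⟨true, μ true 0⟩⟩
  let r : Z → Z → Prop := Linked S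
  let cls : Z → Quot r := Quot.mk r
  -- The marks identify the distinguished elements, so that only these have their types; the Boolean
  -- keeps the two structures apart.
  let t : Z → Set Φ × Set (Fin 2) × Bool := fun z =>
    ({χ | χ.1.Realize fun _ => z.2}, {i | z.2 = μ z.1 i}, z.1)
  let e := Finite.equivFin ((Fin 2 → Fin 2) → Set Φ)
  obtain ⟨P, o, o₂, finP, cardP, htyp, hdiag, hlink, hwit, hbis⟩ :=
    Mosaic.exists_finite_unravelling (Z := Z) (D := Fin (Nat.card ((Fin 2 → Fin 2) → Set Φ)))
      Sigma.fst cls t (fun z z' => e (truths Φ z z')) (fun d => restrictTo τ (e.symm d))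
      (fun x y h => congrArg (fun s => s.2.2) h)
      (by
        rintro ⟨b, x⟩ ⟨c, y⟩ hxy ⟨b', x'⟩ hb hne
        change b' = b at hb
        subst hb
        obtain ⟨y', h1, h2⟩ := (hS.exists_of_eqvGen (Quot.eqvGen_exact hxy)).1 x'
        refine ⟨⟨c, y'⟩, rfl, ?_, (Quot.eqvGen_sound h1).symm, ?_⟩
        · intro h
          have hy : y' = y := eq_of_heq (Sigma.mk.inj h).2
          exact hne (congrArg (Sigma.mk b') (h2.pair_eq_iff.2 hy.symm).symm)
        · simp only [Equiv.symm_apply_apply]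
          exact (restrictTo_truths_eq h2).symm)
      hK (by simpa using hD) hT hkey
  simp only [EmbeddingLike.apply_eq_iff_eq, Equiv.symm_apply_apply] at hwit hbis
  have side_eq : ∀ {x y : Z}, t x = t y → x.1 = y.1 := fun h => congrArg (fun s => s.2.2) h
  let G : Bool → Type w' := fun b => ULift.{w'} {p : P // (o p).1 = b}
  have hex : ∀ b (p p' : G b), ∃ x : F b, o₂ p.down.1 p'.down.1 = ⟨b, x⟩ := by
    rintro b ⟨⟨p, hp⟩⟩ ⟨⟨p', hp'⟩⟩
    have h : (o₂ p p').1 = b := by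
      by_cases hpp : p = p'
      · subst hpp; rw [hdiag]; exact hp
      · exact (side_eq (hlink p p' hpp).1).trans hp
    subst h
    exact ⟨_, rfl⟩
  choose f hf using hex
  have ho : ∀ b (p : G b), o p.down.1 = ⟨b, f b p p⟩ := fun b p => by rw [← hf, hdiag]
  have mk_inj : ∀ {b : Bool} {x y : F b}, (⟨b, x⟩ : Z) = ⟨b, y⟩ → x = y := fun h =>
    eq_of_heq (Sigma.mk.inj h).2
  have down_ne : ∀ {b : Bool} {p p' : G b}, p ≠ p' → p.down.1 ≠ p'.down.1 := fun h h' =>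
    h (ULift.ext _ _ (Subtype.ext h'))
  have unr : ∀ b, IsUnravelling Φ (f b) := by
    intro b
    refine ⟨fun p p' χ hχ => ?_, fun p p' hne => ?_, fun p z hz => ?_⟩
    · by_cases hpp : p = p'
      · rw [hpp]
      · have h := (hlink _ _ (down_ne hpp)).1
        rw [hf, ho] at h
        have h' : (⟨χ, hχ⟩ : Φ) ∈ (t ⟨b, f b p p'⟩).1 ↔ (⟨χ, hχ⟩ : Φ) ∈ (t ⟨b, f b p p⟩).1 := by
          rw [h]
        exact h'
    · have h := (hlink _ _ (down_ne hne)).2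
      rw [hf, hf] at h
      exact fun h' => h (by rw [h'])
    · obtain ⟨p', hne, ht, hπ⟩ := hwit p.down.1 ⟨b, z⟩ p.down.2.symm
        (by rw [ho]; exact fun h => hz (mk_inj h))
      let q : G b := ⟨⟨p', side_eq ht⟩⟩
      refine ⟨q, fun h => hne (congrArg (fun s : G b => s.down.1) h), fun χ hχ => ?_⟩
      have h1 := hf b p q
      have h2 := hf b q p
      simp only [q] at h1 h2
      rw [h1, h2, ho] at hπ
      have key : ∀ h : Fin 2 → Fin 2, χ.Realize (![f b p p, z] ∘ h) ↔
          χ.Realize (![f b p q, f b q p] ∘ h) := by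
        intro h
        have := congrFun hπ h
        rw [← mem_truths (χ := (⟨χ, hχ⟩ : Φ)), ← mem_truths (χ := (⟨χ, hχ⟩ : Φ)), ← this]
      have hrev : ∀ x y : F b, ![x, y] ∘ Fin.rev = ![y, x] := fun x y => by
        funext i; fin_cases i <;> rfl
      exact ⟨key id, by simpa only [hrev] using key Fin.rev⟩
  let str : ∀ b, L.Structure (G b) := fun b => patchwork Φ (f b)
  have iso : ∀ b c (p p' : G b) (q q' : G c), cls (o p.down.1) = cls (o q.down.1) →
      (p = p' ↔ q = q') →
      (p ≠ p' → restrictTo τ (truths Φ (o₂ p.down.1 p'.down.1) (o₂ p'.down.1 p.down.1)) =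
        restrictTo τ (truths Φ (o₂ q.down.1 q'.down.1) (o₂ q'.down.1 q.down.1))) →
      IsPartialIso τ ![p, p'] ![q, q'] := by
    intro b c p p' q q' hc heq hne
    refine (unr b).isPartialIso_patchwork (unr c) heq ?_ ?_
    · intro k R g hR hg
      rw [ho, ho] at hc
      obtain ⟨y, -, h2⟩ := (hS.exists_of_eqvGen (Quot.eqvGen_exact hc)).1 (f b p p)
      exact h2.realize_rel_iff hR g fun _ => 0
    · intro h k R g hR hg
      have h' := hne h
      rw [hf, hf, hf, hf] at h'
      exact realize_iff_of_restrictTo_eq h' hR hg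
  have move : ∀ b c (p p' : G b) (q : G c), cls (o p.down.1) = cls (o q.down.1) →
      ∃ q' : G c, IsPartialIso τ ![p, p'] ![q, q'] ∧ cls (o p'.down.1) = cls (o q'.down.1) := by
    intro b c p p' q hc
    by_cases hpp : p = p'
    · subst hpp
      exact ⟨q, iso b c p p q q hc (by simp) (fun h => absurd rfl h), hc⟩
    · obtain ⟨q', hs, hne, hc', hρ⟩ := hbis _ _ hc p'.down.1
        (p'.down.2.trans p.down.2.symm) (down_ne (Ne.symm hpp))
      let q'' : G c := ⟨⟨q', hs.trans q.down.2⟩⟩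
      have hqq : q ≠ q'' := fun h => hne (congrArg (fun s : G c => s.down.1) h).symm
      exact ⟨q'', iso b c p p' q q'' hc (iff_of_false hpp hqq) (fun _ => hρ.symm), hc'.symm⟩
  choose pick hpick using htyp
  let ν : ∀ b, Fin 2 → G b := fun b i => ⟨⟨pick ⟨b, μ b i⟩, side_eq (hpick _)⟩⟩
  -- Since linked patterns preserve types, the copies of distinguished elements imitate exactly
  -- these elements in all their links.
  have marked : ∀ {z : Z} {b : Bool} {i : Fin 2}, t z = t ⟨b, μ b i⟩ → z = ⟨b, μ b i⟩ := by
    rintro ⟨c, x⟩ b i h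
    obtain rfl : c = b := side_eq h
    have h' : i ∈ (t ⟨c, x⟩).2.1 := by rw [h]; exact rfl
    have h'' : x = μ c i := h'
    rw [h'']
  have hν : ∀ b i, o (ν b i).down.1 = ⟨b, μ b i⟩ := fun b i => marked (hpick _)
  have hν₂ : ∀ b i j, o₂ (ν b i).down.1 (ν b j).down.1 = ⟨b, μ b i⟩ := by
    intro b i j
    by_cases h : (ν b i).down.1 = (ν b j).down.1
    · rw [← h, hdiag, hν]
    · exact marked ((hlink _ _ h).1.trans (by rw [hν]))
  have hνeq : ∀ b i j, ν b i = ν b j ↔ μ b i = μ b j := by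
    intro b i j
    constructor
    · intro h
      have := congrArg (fun s : G b => o s.down.1) h
      simp only [hν] at this
      exact mk_inj this
    · intro h
      simp only [ν, h]
  have hcls : ∀ i, cls (o (ν true i).down.1) = cls (o (ν false i).down.1) := by
    intro i
    rw [hν, hν]
    exact Quot.sound ⟨_, _, rfl, rfl, hμ i⟩
  have finG : ∀ b, Finite (G b) := fun b => inferInstance
  refine ⟨G, str, ν, fun p q => cls (o p.down.1) = cls (o q.down.1), finG, ?_, ?_, ?_, ?_, hcls⟩
  · intro b
    refine le_trans ?_ cardP
    rw [Nat.card_congr Equiv.ulift]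
    exact Finite.card_subtype_le _
  · intro b χ hχ
    rw [(unr b).realize_patchwork hΦ χ hχ]
    have : pattern (f b) (ν b) = μ b := by
      funext i
      exact mk_inj ((hf b _ _).symm.trans (hν₂ b i i.rev))
    rw [this]
  · have h := iso true false (ν true 0) (ν true 1) (ν false 0) (ν false 1) (hcls 0)
      (by rw [hνeq, hνeq]; exact hiso.1 0 1) (fun _ => by
        rw [hν₂, hν₂, hν₂, hν₂]
        refine restrictTo_truths_eq ?_
        have h1 : ∀ b, ![μ b 0, μ b 1] = μ b := fun b => by funext i; fin_cases i <;> rfl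
        rwa [h1, h1])
    have h1 : ∀ b, ![ν b 0, ν b 1] = ν b := fun b => by funext i; fin_cases i <;> rfl
    rwa [h1, h1] at h
  -- Totality follows from one move starting at the distinguished points, whose classes agree.
  · have surj : ∀ b c (p : G b), ∃ q : G c, cls (o p.down.1) = cls (o q.down.1) := by
      intro b c p
      have h0 : cls (o (ν b 0).down.1) = cls (o (ν c 0).down.1) := by
        cases b <;> cases c
        exacts [rfl, (hcls 0).symm, hcls 0, rfl]
      obtain ⟨q, -, hq⟩ := move b c (ν b 0) p (ν c 0) h0
      exact ⟨q, hq⟩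
    refine ⟨fun p => surj _ _ p, fun q => ?_, fun p q h p' => move _ _ p p' q h,
      fun p q h q' => ?_⟩
    · obtain ⟨p, hp⟩ := surj false true q
      exact ⟨p, hp.symm⟩
    · obtain ⟨p', h1, h2⟩ := move _ _ q q' p h.symm
      exact ⟨p', h1.symm, h2.symm⟩

end Family

end TwoVar

/-! ### Extension to full assignments, and the size bound -/

namespace TwoVar

variable {L : FirstOrder.Language.{u, v}} {τ : Signature L}

theorem card_set (X : Type*) [Finite X] : Nat.card (Set X) = 2 ^ Nat.card X := by
  have := Fintype.ofFinite X
  classical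
  rw [Nat.card_eq_fintype_card, Fintype.card_set, Nat.card_eq_fintype_card]

/-- Variables outside the tuple repeat one of its components, which keeps the partial isomorphism;
for the empty tuple any pair in `S` serves, its partial isomorphism coming from a single forth move.
-/
theorem IsBisimulation.exists_extension {A B : Type*} [L.Structure A] [L.Structure B] [Nonempty A]
    {S : A → B → Prop} (hS : IsBisimulation τ S) {n : ℕ} (x₀ : Fin n ↪ Fin 2) {a : Fin n → A}
    {b : Fin n → B} (hab : IsPartialIso τ a b) (h : ∀ i, S (a i) (b i)) :
    ∃ (μ : Fin 2 → A) (μ' : Fin 2 → B), μ ∘ x₀ = a ∧ μ' ∘ x₀ = b ∧ IsPartialIso τ μ μ' ∧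
      ∀ i, S (μ i) (μ' i) := by
  cases n with
  | zero =>
    obtain ⟨a₀⟩ := ‹Nonempty A›
    obtain ⟨b₀, h₀⟩ := hS.global_left a₀
    obtain ⟨b', h', -⟩ := hS.forth a₀ b₀ h₀ a₀
    exact ⟨fun _ => a₀, fun _ => b₀, Subsingleton.elim _ _, Subsingleton.elim _ _,
      h'.comp fun _ => 0, fun _ => h₀⟩
  | succ n =>
    have hg := Function.leftInverse_invFun x₀.injective
    refine ⟨a ∘ Function.invFun x₀, b ∘ Function.invFun x₀, ?_, ?_, hab.comp _, fun _ => h _⟩ <;>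
    · funext i
      simp [hg i]

theorem Formula.Holds.realize {A : Type w} [L.Structure A] {n : ℕ} {φ : Formula L}
    {x₀ : Fin n ↪ Fin 2} {a : Fin n → A} (h : φ.Holds x₀ a) (hφ : φ.freeVars ⊆ Set.range x₀)
    {μ : Fin 2 → A} (hμ : μ ∘ x₀ = a) : φ.Realize μ := by
  obtain ⟨ν, hν, hr⟩ := h
  refine (φ.realize_congr fun x hx => ?_).1 hr
  obtain ⟨i, rfl⟩ := hφ hx
  rw [hν, ← hμ, Function.comp]

end TwoVar

theorem theorem2 :
    ∃ C : ℕ, ∀ (L : FirstOrder.Language.{u, v}) [L.IsRelational] (τ : TwoVar.Signature L)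
      (n : ℕ) (x₀ : Fin n ↪ Fin 2) (φ ψ : TwoVar.Formula L),
      φ.freeVars ⊆ Set.range x₀ → ψ.freeVars ⊆ Set.range x₀ →
      TwoVar.JointlyConsistent.{u, v, w} τ x₀ φ ψ →
      ∃ (B₁ B₂ : Type w') (_ : Nonempty B₁) (_ : Nonempty B₂) (_ : Finite B₁) (_ : Finite B₂)
        (_ : L.Structure B₁) (_ : L.Structure B₂) (b₁ : Fin n → B₁) (b₂ : Fin n → B₂),
        Nat.card B₁ ≤ 2 ^ 2 ^ (C * (φ.size + ψ.size)) ∧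
        Nat.card B₂ ≤ 2 ^ 2 ^ (C * (φ.size + ψ.size)) ∧
        φ.Holds x₀ b₁ ∧ ψ.Holds x₀ b₂ ∧ TwoVar.Bisimilar τ b₁ b₂ := by
  -- With `K = 2 ^ 2 ^ (s + 4)` the domains have at most `K ^ 14 ≤ 2 ^ 2 ^ (s + 8)` elements, and `s
  -- + 8 ≤ 9 * s` because `s` is positive.
  refine ⟨9, fun L _ τ n x₀ φ ψ hφ hψ => ?_⟩
  rintro ⟨A, B, _, _, _, _, a, b, ha, hb, hab, S, hS, hSab⟩
  obtain ⟨μ, μ', hμ, hμ', hiso, hSμ⟩ := hS.exists_extension x₀ hab hSab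
  let F : Bool → Type w := fun c => Bool.rec B A c
  let inst : ∀ c, L.Structure (F c) := fun c => match c with
    | true => (inferInstance : L.Structure A)
    | false => (inferInstance : L.Structure B)
  let Φ := φ.subformulas ∪ ψ.subformulas
  have finΦ : Φ.Finite := φ.finite_subformulas.union ψ.finite_subformulas
  have hΦ : TwoVar.SubformulaClosed Φ := by
    rintro χ (h | h)
    · exact (TwoVar.Formula.subformulas_subset h).trans Set.subset_union_left
    · exact (TwoVar.Formula.subformulas_subset h).trans Set.subset_union_right
  let s := φ.size + ψ.size
  have hs : 0 < s := Nat.add_pos_left φ.size_pos _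
  have hm : Φ.ncard ≤ s := (Set.ncard_union_le _ _).trans
    (Nat.add_le_add φ.ncard_subformulas_le ψ.ncard_subformulas_le)
  have : Finite Φ := finΦ
  have hpow : s < 2 ^ s := Nat.lt_two_pow_self
  have cardΦ : Nat.card (Set Φ) = 2 ^ Φ.ncard := by
    rw [TwoVar.card_set, Nat.card_coe_set_eq]
  have cardT : Nat.card (Set Φ × Set (Fin 2) × Bool) = 2 ^ (Φ.ncard + 3) := by
    rw [Nat.card_prod, Nat.card_prod, cardΦ]
    simp [pow_add]
  have h3 : Φ.ncard + 3 ≤ 2 ^ (s + 3) := by rw [pow_add]; omega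
  have h4 : 2 ^ (s + 4) = 2 ^ (s + 3) + 2 ^ (s + 3) := by ring
  obtain ⟨G, _, ν, S', finG, cardG, hG, hisoG, hS', hνS⟩ :=
    @TwoVar.exists_finite_bisimulation.{u, v, w, w'} L τ F inst Φ _ S hS hΦ finΦ
      (fun c => match c with
        | true => μ
        | false => μ') hSμ hiso (2 ^ 2 ^ (s + 4))
      (Nat.le_self_pow (by positivity) 2)
      (by
        rw [Nat.card_fun, cardΦ, ← pow_mul]
        simp only [Nat.card_eq_fintype_card, Fintype.card_fun, Fintype.card_fin]
        refine Nat.pow_le_pow_right (by norm_num) ?_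
        rw [pow_add]; omega)
      (by
        rw [cardT]
        exact Nat.pow_le_pow_right (by norm_num) (by omega))
      (by
        rw [Nat.card_prod, TwoVar.card_set, cardT, ← pow_add]
        refine Nat.pow_le_pow_right (by norm_num) ?_
        have : 2 ^ (Φ.ncard + 3) ≤ 2 ^ (s + 3) := Nat.pow_le_pow_right (by norm_num) (by omega)
        omega)
  have bound : ∀ c, Nat.card (G c) ≤ 2 ^ 2 ^ (9 * s) := fun c => (cardG c).trans <| by
    rw [← pow_mul]
    refine Nat.pow_le_pow_right (by norm_num) ?_
    calc 2 ^ (s + 4) * 14 ≤ 2 ^ (s + 4) * 2 ^ 4 := by gcongr; norm_num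
      _ = 2 ^ (s + 8) := by ring
      _ ≤ 2 ^ (9 * s) := Nat.pow_le_pow_right (by norm_num) (by omega)
  exact ⟨G true, G false, ⟨ν true 0⟩, ⟨ν false 0⟩, finG true, finG false, inferInstance,
    inferInstance, ν true ∘ x₀, ν false ∘ x₀, bound true, bound false,
    ⟨ν true, fun _ => rfl, (hG true φ (Or.inl φ.self_mem_subformulas)).2 (ha.realize hφ hμ)⟩,
    ⟨ν false, fun _ => rfl, (hG false ψ (Or.inr ψ.self_mem_subformulas)).2 (hb.realize hψ hμ')⟩,
    hisoG.comp x₀, S', hS', fun i => hνS (x₀ i)⟩
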